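/- Let $K$ be an algebraically closed field of characteristic zero, $x=(x_1,x_2,x_3)$, and let $V=\{f=0\}\subset K^3$ be the surface defined by an irreducible polynomial $f\in K[x]$. Assume that $V$ is not cylindrical, i.e. $\nabla f\cdot a\neq 0$ in $K[x]$ for every $a\in K^3\setminus\{0\}$. The curve defined by a non-constant $P\in K(t)^3$ is the Zariski closure of the set of its values; $P$ is proper if $K(P)=K(t)$, i.e. if it is birational onto its curve; a rational space curve is a curve defined by such a $P$. For $P_1,P_2\in K(t)^3$ we say that $P_1+P_2$ parametrizes $V$ if the points $P_1(t_1)+P_2(t_2)$, for $t_1,t_2\in K$ where $P_1$, $P_2$ are defined, have Zariski closure $V$; and $V$ is translational if this holds for some non-constant $P_1,P_2$. Let $a\in K^3\setminus\{0\}$, and let $P_1\in K(t)^3$ be proper, defining a curve $C_1\subset\{f=\nabla f\cdot a=0\}$ that is not a line. If $V$ is translational, assume moreover that $C_1$ comes from a translational representation of $V$ with tangent direction $a$: there are non-constant $Q_1,Q_2\in K(t)^3$ such that $Q_1+Q_2$ parametrizes $V$, and $t^0\in K$ at which $Q_2$ is defined, such that $Q_2'(t^0)=a$ and $C_1$ is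 the curve defined by $Q_1(t)+Q_2(t^0)$. Write $$f(P_1(t_1)+x)=\tilde h(x)\,\Psi(x,t_1)\,p(t_1),\qquad \Psi(x,t_1)=\sum_{i=0}^n\tilde h_i(x)\,t_1^i,\qquad \gcd(\tilde h_0,\ldots,\tilde h_n)=1,$$ with $\tilde h,\tilde h_i\in K[x]$ and $p\in K(t_1)$, and let $V(\tilde h_0,\ldots,\tilde h_n)\subset K^3$ be the set of common zeros of the $\tilde h_i$. Then the following are equivalent: 1. $V$ is translational; 2. there is a proper $P_2\in K(t)^3$ such that $P_1+P_2$ parametrizes $V$; 3. there is a rational space curve $C_2\subset V(\tilde h_0,\ldots,\tilde h_n)$. Moreover, for every non-constant $P_2\in K(t)^3$ with curve $C_2$, $P_1+P_2$ parametrizes $V$ if and only if $C_2\subset V(\tilde h_0,\ldots,\tilde h_n)$; and every rational space curve $D\subset V(\tilde h_0,\ldots,\tilde h_n)$ has a proper parametrization $P_2$, and $P_1+P_2$ then parametrizes $V$. -/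

import Mathlib

namespace TransSurf

variable {K : Type*} [Field K]

/-! ### Points, Zariski closure, the surface -/

/-- The Zariski closure of a set of points of affine `3`-space. -/
def zariskiClosure (S : Set (Fin 3 → K)) : Set (Fin 3 → K) :=
  MvPolynomial.zeroLocus K (MvPolynomial.vanishingIdeal K S)

/-- The common zero set in affine `3`-space of a set of polynomials. -/
def zeroSet (F : Set (MvPolynomial (Fin 3) K)) : Set (Fin 3 → K) :=
  {x | ∀ q ∈ F, MvPolynomial.eval x q = 0}

/-- The directional derivative `a₁ ∂f/∂x₁ + a₂ ∂f/∂x₂ + a₃ ∂f/∂x₃`. -/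
noncomputable def dirDeriv (a : Fin 3 → K) (f : MvPolynomial (Fin 3) K) :
    MvPolynomial (Fin 3) K :=
  ∑ j, MvPolynomial.C (a j) * MvPolynomial.pderiv j f

/-- The surface `f = 0` is cylindrical: `∇f · a = 0` identically, for some constant vector
`a ≠ 0`. -/
def IsCylindrical (f : MvPolynomial (Fin 3) K) : Prop :=
  ∃ a : Fin 3 → K, a ≠ 0 ∧ dirDeriv a f = 0

/-- The set is a line of affine `3`-space. -/
def IsLine (S : Set (Fin 3 → K)) : Prop :=
  ∃ b v : Fin 3 → K, v ≠ 0 ∧ S = {x | ∃ s : K, x = b + s • v}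

/-! ### Rational parametrizations of space curves -/

/-- The triple lies in `K(t)³ \ K³`. -/
def Nonconstant (P : Fin 3 → RatFunc K) : Prop :=
  ¬ ∃ c : Fin 3 → K, ∀ j, P j = RatFunc.C (c j)

/-- The parameter value `t` is not a pole of any component of `P`. -/
def DefinedAt (P : Fin 3 → RatFunc K) (t : K) : Prop :=
  ∀ j, (P j).denom.eval t ≠ 0

/-- The point `P(t)`. It is only used where `P` is defined at `t`. -/
noncomputable def valueAt (P : Fin 3 → RatFunc K) (t : K) : Fin 3 → K :=
  fun j => (P j).eval (RingHom.id K) t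

/-- The derivative `P'(t)`, by the quotient rule. It is only used where `P` is defined at `t`. -/
noncomputable def derivAt (P : Fin 3 → RatFunc K) (t : K) : Fin 3 → K :=
  fun j => ((P j).num.derivative.eval t * (P j).denom.eval t
      - (P j).num.eval t * (P j).denom.derivative.eval t) / (P j).denom.eval t ^ 2

/-- The space curve defined by the rational parametrization `P`: the Zariski closure of its image.
(It is a curve if `P` is not constant.) -/
def curve (P : Fin 3 → RatFunc K) : Set (Fin 3 → K) :=
  zariskiClosure {x | ∃ t, DefinedAt P t ∧ x = valueAt P t}

/-- A rational space curve. -/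
def IsRationalCurve (D : Set (Fin 3 → K)) : Prop :=
  ∃ P : Fin 3 → RatFunc K, Nonconstant P ∧ curve P = D

/-- `P` is proper, i.e. birational onto the curve that it parametrizes: its components generate
the field `K(t)` over `K`. -/
def IsProper (P : Fin 3 → RatFunc K) : Prop :=
  IntermediateField.adjoin K (Set.range P) = ⊤

/-! ### Translational surfaces -/

/-- `P₁(t₁) + P₂(t₂)` parametrizes the surface `f = 0`: its image is Zariski dense in the
surface. (As `t₁`, `t₂` are independent variables, the sum is defined at `(t₁, t₂)` exactly when
`P₁` is defined at `t₁` and `P₂` is defined at `t₂`.) -/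
def SumParametrizes (f : MvPolynomial (Fin 3) K) (P₁ P₂ : Fin 3 → RatFunc K) : Prop :=
  zariskiClosure {x | ∃ t₁ t₂, DefinedAt P₁ t₁ ∧ DefinedAt P₂ t₂ ∧
    x = valueAt P₁ t₁ + valueAt P₂ t₂} = zeroSet {f}

/-- The surface `f = 0` is translational. -/
def IsTranslational (f : MvPolynomial (Fin 3) K) : Prop :=
  ∃ P₁ P₂ : Fin 3 → RatFunc K, Nonconstant P₁ ∧ Nonconstant P₂ ∧ SumParametrizes f P₁ P₂

/-- `P₁` is a proper parametrization of a first curve for the surface `f = 0`, computed from the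
direction `a ≠ 0`: its curve `C₁` is not a line and lies on `f = ∇f · a = 0` (so it is a component
of that algebraic set). The set `f = ∇f · a = 0` may have other rational components; for a
translational surface `C₁` is a component that comes from a representation
`Q₁(t₁) + Q₂(t₂)` of the surface, namely the curve `Q₁(t₁) + Q₂(t⁰)` with `Q₂'(t⁰) = a`. -/
structure IsFirstCurveParam (f : MvPolynomial (Fin 3) K) (a : Fin 3 → K)
    (P₁ : Fin 3 → RatFunc K) : Prop where
  direction_ne_zero : a ≠ 0
  proper : IsProper P₁
  not_line : ¬ IsLine (curve P₁)
  subset : curve P₁ ⊆ zeroSet {f, dirDeriv a f}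
  of_translational : IsTranslational f →
    ∃ Q₁ Q₂ : Fin 3 → RatFunc K, Nonconstant Q₁ ∧ Nonconstant Q₂ ∧ SumParametrizes f Q₁ Q₂ ∧
      ∃ t₀ : K, DefinedAt Q₂ t₀ ∧ derivAt Q₂ t₀ = a ∧
        curve P₁ = curve (fun j => Q₁ j + RatFunc.C (valueAt Q₂ t₀ j))

/-! ### The factorization of `f(P₁(t₁) + x)` -/

/-- The polynomial `f(P₁(t₁) + x)` in `x` with coefficients in `K(t₁)`. -/
noncomputable def shifted (f : MvPolynomial (Fin 3) K) (P₁ : Fin 3 → RatFunc K) :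
    MvPolynomial (Fin 3) (RatFunc K) :=
  MvPolynomial.aeval (fun j => MvPolynomial.C (P₁ j) + MvPolynomial.X j) f

/-- A polynomial of `K[x]`, seen in `K(t₁)[x]`. -/
noncomputable def liftPoly (q : MvPolynomial (Fin 3) K) : MvPolynomial (Fin 3) (RatFunc K) :=
  MvPolynomial.map (algebraMap K (RatFunc K)) q

/-- The polynomial `Ψ(x, t₁) = h₀(x) + h₁(x) t₁ + ⋯ + hₙ(x) t₁ⁿ`. -/
noncomputable def psi {n : ℕ} (h : Fin (n + 1) → MvPolynomial (Fin 3) K) :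
    MvPolynomial (Fin 3) (RatFunc K) :=
  ∑ i, liftPoly (h i) * MvPolynomial.C (RatFunc.X ^ (i : ℕ))

/-- `f(P₁(t₁) + x) = h̃(x) Ψ(x, t₁) p(t₁)`, where `Ψ` has the coefficients `h₀, …, hₙ` and
`gcd(h₀, …, hₙ) = 1`. -/
structure IsFactorization (f : MvPolynomial (Fin 3) K) (P₁ : Fin 3 → RatFunc K)
    (htilde : MvPolynomial (Fin 3) K) {n : ℕ} (h : Fin (n + 1) → MvPolynomial (Fin 3) K)
    (p : RatFunc K) : Prop where
  eq : shifted f P₁ = liftPoly htilde * psi h * MvPolynomial.C p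
  gcd_eq_one : ∀ d : MvPolynomial (Fin 3) K, (∀ i, d ∣ h i) → IsUnit d

end TransSurf

open Filter

namespace TransSurf

variable {K : Type*} [Field K]

/-! ### Evaluation of rational functions -/

/-! The pivot is a pointwise equivalence: for `x ∈ K³`, the translate `C₁ + x` lies in `V` if and
only if all `hᵢ(x)` vanish. It reduces to `h̃` being a unit. Otherwise `h̃` would be, up to units,
every translate `f(x + P₁(u))` of the irreducible `f`, so `f` would be semi-invariant under some
nonzero translation, hence constant in that direction, and `V` would be cylindrical
(`IsFactorization.isUnit_htilde`).

So `C₂ ⊆ V(h₀, …, hₙ)` says that `f` vanishes at all `P₁(t₁) + P₂(t₂)`. Density of these sums is the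
harder half (`dvd_of_mem_vanishingIdeal_sumSet`). If a polynomial outside `(f)` also vanished on
them, elimination would give, for each coordinate `xₖ`, a vanishing polynomial free of `xₖ` whose
gradient is not identically zero on the sums. That gradient is orthogonal to both tangents `P₁'` and
`P₂'`, so they are parallel in each coordinate plane; fixing `t₂` gives `P₁'` a constant direction
and makes `C₁` a line.

Finally, a representation `Q₁ + Q₂` is recentred as `(Q₁ + Q₂(t⁰)) + (Q₂ - Q₂(t⁰))`, and Lüroth's
theorem makes the second parametrization proper. -/

theorem denom_eval_add {x y : RatFunc K} {t : K} (hx : x.denom.eval t ≠ 0)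
    (hy : y.denom.eval t ≠ 0) : (x + y).denom.eval t ≠ 0 := fun h0 => by
  obtain ⟨c, hc⟩ := RatFunc.denom_add_dvd x y
  have := congrArg (Polynomial.eval t) hc
  rw [Polynomial.eval_mul, Polynomial.eval_mul, h0, zero_mul] at this
  exact mul_ne_zero hx hy this

theorem denom_eval_mul {x y : RatFunc K} {t : K} (hx : x.denom.eval t ≠ 0)
    (hy : y.denom.eval t ≠ 0) : (x * y).denom.eval t ≠ 0 := fun h0 => by
  obtain ⟨c, hc⟩ := RatFunc.denom_mul_dvd x y
  have := congrArg (Polynomial.eval t) hc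
  rw [Polynomial.eval_mul, Polynomial.eval_mul, h0, zero_mul] at this
  exact mul_ne_zero hx hy this

theorem denom_eval_C (c t : K) : (RatFunc.C c).denom.eval t ≠ 0 := by simp

theorem eval_add_of_denom {x y : RatFunc K} {t : K} (hx : x.denom.eval t ≠ 0)
    (hy : y.denom.eval t ≠ 0) :
    (x + y).eval (RingHom.id K) t = x.eval (RingHom.id K) t + y.eval (RingHom.id K) t :=
  RatFunc.eval_add _ _ hx hy

theorem eval_mul_of_denom {x y : RatFunc K} {t : K} (hx : x.denom.eval t ≠ 0)
    (hy : y.denom.eval t ≠ 0) :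
    (x * y).eval (RingHom.id K) t = x.eval (RingHom.id K) t * y.eval (RingHom.id K) t :=
  RatFunc.eval_mul _ _ hx hy

theorem denom_eval_finsetSum {ι : Type*} (s : Finset ι) {x : ι → RatFunc K} {t : K}
    (hx : ∀ i, (x i).denom.eval t ≠ 0) :
    (∑ i ∈ s, x i).denom.eval t ≠ 0 ∧
      (∑ i ∈ s, x i).eval (RingHom.id K) t = ∑ i ∈ s, (x i).eval (RingHom.id K) t := by
  classical
  induction s using Finset.induction_on with
  | empty => simp
  | insert i s his ih =>
    rw [Finset.sum_insert his, Finset.sum_insert his, eval_add_of_denom (hx i) ih.1, ih.2]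
    exact ⟨denom_eval_add (hx i) ih.1, rfl⟩

/-- Substituting a rational triple into a polynomial commutes with evaluation. -/
theorem eval_aeval {P : Fin 3 → RatFunc K} {t : K} (ht : DefinedAt P t)
    (q : MvPolynomial (Fin 3) K) :
    (MvPolynomial.aeval P q).denom.eval t ≠ 0 ∧
      (MvPolynomial.aeval P q).eval (RingHom.id K) t = MvPolynomial.eval (valueAt P t) q := by
  induction q using MvPolynomial.induction_on with
  | C a =>
    rw [MvPolynomial.aeval_C, RatFunc.algebraMap_eq_C]
    exact ⟨denom_eval_C a t, by simp⟩
  | add p q hp hq =>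
    rw [map_add, map_add, eval_add_of_denom hp.1 hq.1, hp.2, hq.2]
    exact ⟨denom_eval_add hp.1 hq.1, rfl⟩
  | mul_X p j hp =>
    rw [map_mul, map_mul, MvPolynomial.aeval_X, MvPolynomial.eval_X,
      eval_mul_of_denom hp.1 (ht j), hp.2]
    exact ⟨denom_eval_mul hp.1 (ht j), rfl⟩

theorem eventually_denom (x : RatFunc K) : ∀ᶠ t in cofinite, x.denom.eval t ≠ 0 := by
  have := Polynomial.finite_setOfPred_isRoot x.denom_ne_zero
  simpa [Filter.eventually_cofinite, Polynomial.IsRoot] using this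

theorem eventually_eval_ne_zero {x : RatFunc K} (hx : x ≠ 0) :
    ∀ᶠ t in cofinite, x.eval (RingHom.id K) t ≠ 0 := by
  have h1 := Polynomial.finite_setOfPred_isRoot (RatFunc.num_ne_zero hx)
  have h2 : ∀ᶠ t in cofinite, x.num.eval t ≠ 0 := by
    simpa [Filter.eventually_cofinite, Polynomial.IsRoot] using h1
  filter_upwards [h2, eventually_denom x] with t ht hd
  simpa [RatFunc.eval] using ⟨ht, hd⟩

theorem eventually_definedAt (P : Fin 3 → RatFunc K) : ∀ᶠ t in cofinite, DefinedAt P t :=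
  eventually_all.2 fun j => eventually_denom (P j)

/-- A polynomial vanishes at the values of `P` if and only if it vanishes at `P`. -/
theorem forall_eval_valueAt_eq_zero_iff [Infinite K] (P : Fin 3 → RatFunc K)
    (q : MvPolynomial (Fin 3) K) :
    (∀ t, DefinedAt P t → MvPolynomial.eval (valueAt P t) q = 0) ↔
      MvPolynomial.aeval P q = 0 := by
  constructor
  · intro h
    by_contra h0
    obtain ⟨t, h1, h2⟩ := ((eventually_eval_ne_zero h0).and (eventually_definedAt P)).exists
    exact h1 ((eval_aeval h2 q).2.trans (h t h2))
  · intro h t ht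
    rw [← (eval_aeval ht q).2, h, RatFunc.eval_zero]

theorem eventually_eval_valueAt_ne_zero {P : Fin 3 → RatFunc K} {q : MvPolynomial (Fin 3) K}
    {u : K} (hu : DefinedAt P u) (hq : MvPolynomial.eval (valueAt P u) q ≠ 0) :
    ∀ᶠ t in cofinite, MvPolynomial.eval (valueAt P t) q ≠ 0 := by
  have h0 : MvPolynomial.aeval P q ≠ 0 := fun h => hq (by
    rw [← (eval_aeval hu q).2, h, RatFunc.eval_zero])
  filter_upwards [eventually_eval_ne_zero h0, eventually_definedAt P] with t h1 h2
  rwa [← (eval_aeval h2 q).2]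

/-! ### Zariski closures and curves -/

theorem mem_zariskiClosure {S : Set (Fin 3 → K)} {y : Fin 3 → K} :
    y ∈ zariskiClosure S ↔ ∀ q : MvPolynomial (Fin 3) K,
      (∀ x ∈ S, MvPolynomial.eval x q = 0) → MvPolynomial.eval y q = 0 := by
  simp only [zariskiClosure, MvPolynomial.mem_zeroLocus_iff,
    MvPolynomial.mem_vanishingIdeal_iff]
  rfl

theorem subset_zariskiClosure (S : Set (Fin 3 → K)) : S ⊆ zariskiClosure S :=
  fun _ hx => mem_zariskiClosure.2 fun _ hq => hq _ hx

/-- The curve depends only on the kernel of `q ↦ q(P)`, so reparametrizations with the same kernel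
have the same curve. -/
theorem mem_curve [Infinite K] {P : Fin 3 → RatFunc K} {y : Fin 3 → K} :
    y ∈ curve P ↔ ∀ q : MvPolynomial (Fin 3) K,
      MvPolynomial.aeval P q = 0 → MvPolynomial.eval y q = 0 := by
  simp only [curve, mem_zariskiClosure, ← forall_eval_valueAt_eq_zero_iff]
  constructor
  · intro h q hq
    refine h q ?_
    rintro x ⟨t, ht, rfl⟩
    exact hq t ht
  · intro h q hq
    exact h q fun t ht => hq _ ⟨t, ht, rfl⟩

theorem valueAt_mem_curve {P : Fin 3 → RatFunc K} {t : K} (ht : DefinedAt P t) :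
    valueAt P t ∈ curve P :=
  subset_zariskiClosure _ ⟨t, ht, rfl⟩

theorem curve_subset_zeroSet_iff [Infinite K] {P : Fin 3 → RatFunc K}
    {F : Set (MvPolynomial (Fin 3) K)} :
    curve P ⊆ zeroSet F ↔ ∀ q ∈ F, MvPolynomial.aeval P q = 0 := by
  constructor
  · intro h q hq
    exact (forall_eval_valueAt_eq_zero_iff P q).1 fun t ht => h (valueAt_mem_curve ht) q hq
  · intro h y hy q hq
    exact mem_curve.1 hy q (h q hq)

/-! ### Translations -/

/-- Translation of the rational triple `P` by the vector `x`. -/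
noncomputable def translate (P : Fin 3 → RatFunc K) (x : Fin 3 → K) : Fin 3 → RatFunc K :=
  fun j => P j + RatFunc.C (x j)

theorem DefinedAt.translate {P : Fin 3 → RatFunc K} {t : K} (ht : DefinedAt P t)
    (x : Fin 3 → K) : DefinedAt (translate P x) t :=
  fun j => denom_eval_add (ht j) (denom_eval_C _ _)

theorem valueAt_translate {P : Fin 3 → RatFunc K} {t : K} (ht : DefinedAt P t)
    (x : Fin 3 → K) : valueAt (translate P x) t = valueAt P t + x := by
  funext j
  simp only [valueAt, TransSurf.translate, Pi.add_apply]
  rw [eval_add_of_denom (ht j) (denom_eval_C _ _), RatFunc.eval_C, RingHom.id_apply]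

theorem translate_translate (P : Fin 3 → RatFunc K) (x y : Fin 3 → K) :
    translate (translate P x) y = translate P (x + y) := by
  funext j
  simp [translate, add_assoc]

theorem translate_zero (P : Fin 3 → RatFunc K) : translate P 0 = P := by
  funext j
  simp [translate]

theorem definedAt_translate_iff {P : Fin 3 → RatFunc K} {t : K} {x : Fin 3 → K} :
    DefinedAt (translate P x) t ↔ DefinedAt P t := by
  refine ⟨fun h => ?_, fun h => h.translate x⟩
  have := h.translate (-x)
  rwa [translate_translate, add_neg_cancel, translate_zero] at this

theorem aeval_translate_eq_zero_iff [Infinite K] {P : Fin 3 → RatFunc K} {x : Fin 3 → K}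
    {q : MvPolynomial (Fin 3) K} :
    MvPolynomial.aeval (translate P x) q = 0 ↔
      ∀ t, DefinedAt P t → MvPolynomial.eval (valueAt P t + x) q = 0 := by
  rw [← forall_eval_valueAt_eq_zero_iff]
  constructor
  · intro h t ht
    rw [← valueAt_translate ht]
    exact h t (ht.translate x)
  · intro h t ht
    have ht' := definedAt_translate_iff.1 ht
    rw [valueAt_translate ht']
    exact h t ht'

theorem Nonconstant.translate {P : Fin 3 → RatFunc K} (hP : Nonconstant P) (x : Fin 3 → K) :
    Nonconstant (translate P x) := by
  rintro ⟨c, hc⟩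
  refine hP ⟨c - x, fun j => ?_⟩
  have := hc j
  simp only [TransSurf.translate] at this
  rw [Pi.sub_apply, map_sub, ← this, add_sub_cancel_right]

theorem IsProper.nonconstant {P : Fin 3 → RatFunc K} (hP : IsProper P) : Nonconstant P := by
  rintro ⟨c, hc⟩
  have h1 : IntermediateField.adjoin K (Set.range P) = ⊥ := by
    rw [IntermediateField.adjoin_eq_bot_iff]
    rintro _ ⟨j, rfl⟩
    rw [hc j, ← RatFunc.algebraMap_eq_C]
    exact algebraMap_mem _ _
  have h2 : (RatFunc.X : RatFunc K) ∈ (⊥ : IntermediateField K (RatFunc K)) := by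
    rw [← h1, hP]; trivial
  obtain ⟨d, hd⟩ := IntermediateField.mem_bot.1 h2
  refine RatFunc.transcendental_X (K := K) ?_
  rw [← hd]
  exact isAlgebraic_algebraMap d

/-! ### Polynomials that are semi-invariant under a translation -/

/-- The chain rule, needed both for `d/ds` on polynomials over `K[x]` and for `d/dt` on `K(t)`. -/
theorem derivation_aeval {A M : Type*} [CommRing A] [Algebra K A] [AddCommGroup M] [Module A M]
    [Module K M] [IsScalarTower K A M] (D : Derivation K A M) (v : Fin 3 → A)
    (q : MvPolynomial (Fin 3) K) :
    D (MvPolynomial.aeval v q) =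
      ∑ j, MvPolynomial.aeval v (MvPolynomial.pderiv j q) • D (v j) := by
  induction q using MvPolynomial.induction_on with
  | C a => simp
  | add p q hp hq => simp [hp, hq, add_smul, Finset.sum_add_distrib]
  | mul_X p i hp =>
    rw [map_mul, MvPolynomial.aeval_X, Derivation.leibniz, hp]
    simp only [MvPolynomial.pderiv_mul, map_add, map_mul, MvPolynomial.aeval_X, add_smul,
      Finset.sum_add_distrib, Finset.smul_sum, MvPolynomial.pderiv_X]
    rw [add_comm]
    congr 1
    · exact Finset.sum_congr rfl fun j _ => by rw [smul_smul, mul_comm]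
    · rw [Finset.sum_eq_single i]
      · simp
      · intro j _ hj
        simp [hj.symm]
      · simp

/-- A nonzero polynomial that is multiplied by a constant under translation by `v` is constant
in the direction `v`. -/
theorem dirDeriv_eq_zero_of_shift [CharZero K] {f : MvPolynomial (Fin 3) K} (hf : f ≠ 0)
    {v : Fin 3 → K} {c : K}
    (h : MvPolynomial.aeval (fun j => MvPolynomial.X j + MvPolynomial.C (v j)) f =
      MvPolynomial.C c * f) : dirDeriv v f = 0 := by
  let R := MvPolynomial (Fin 3) K
  -- `F(s) = f(x + s v)` is a polynomial in `s` over `K[x]`; the hypothesis becomes `F(s + 1) = c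
  -- F(s)`.
  let w : Fin 3 → Polynomial R := fun j =>
    Polynomial.C (MvPolynomial.X j) + Polynomial.X * Polynomial.C (MvPolynomial.C (v j))
  let F : Polynomial R := MvPolynomial.aeval w f
  have hCc : ∀ d : K, algebraMap K (Polynomial R) d = Polynomial.C (MvPolynomial.C d) :=
    fun d => rfl
  have heval0 : ∀ q : R, (MvPolynomial.aeval w q).eval 0 = q := by
    intro q
    induction q using MvPolynomial.induction_on with
    | C a => simp [hCc]
    | add p q hp hq => simp [hp, hq]
    | mul_X p i hp =>
      rw [map_mul, Polynomial.eval_mul, hp, MvPolynomial.aeval_X]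
      simp [w]
  have hF0 : F ≠ 0 := fun h0 => hf (by rw [← heval0 f]; simp [F] at h0; simp [h0])
  have htaylor : Polynomial.taylor 1 F = Polynomial.C (MvPolynomial.C c) * F := by
    have h1 := congrArg (MvPolynomial.aeval w) h
    rw [map_mul, MvPolynomial.aeval_C, hCc, ← AlgHom.comp_apply, MvPolynomial.comp_aeval] at h1
    rw [← h1]
    change (Polynomial.taylorAlgHom (1 : R)).toRingHom.comp
      (MvPolynomial.aeval w).toRingHom f = _
    rw [← RingHom.coe_coe (MvPolynomial.aeval _)]
    congr 1
    apply MvPolynomial.ringHom_ext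
    · intro r
      simp [hCc]
    · intro i
      simp [w, hCc]
      ring
  -- The shift `s ↦ s + 1` preserves the leading coefficient.
  have hc : (MvPolynomial.C c : R) = 1 := by
    have h1 := congrArg Polynomial.leadingCoeff htaylor
    rw [Polynomial.leadingCoeff_mul, Polynomial.leadingCoeff_C,
      Polynomial.leadingCoeff_taylor] at h1
    exact (mul_right_cancel₀ (Polynomial.leadingCoeff_ne_zero.2 hF0) (by rw [one_mul, ← h1]))
  rw [hc, Polynomial.C_1, one_mul] at htaylor
  -- `F` takes the same value at all natural numbers, which are infinitely many in characteristic
  -- zero, so it is constant.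
  have hn : ∀ n : ℕ, F.eval (n : R) = F.eval 0 := by
    intro n
    induction n with
    | zero => simp
    | succ n ih =>
      rw [← ih]
      conv_rhs => rw [← htaylor, Polynomial.taylor_eval]
      push_cast; rfl
  have hconst : F = Polynomial.C (F.eval 0) := by
    refine Polynomial.eq_of_infinite_eval_eq _ _ ?_
    refine (Set.infinite_range_of_injective (Nat.cast_injective (R := R))).mono ?_
    rintro _ ⟨n, rfl⟩
    simp [hn n]
  have hD := derivation_aeval ((Polynomial.derivative' (R := R)).restrictScalars K) w f
  have hD0 : ((Polynomial.derivative' (R := R)).restrictScalars K)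
      (MvPolynomial.aeval w f) = 0 := by
    change Polynomial.derivative F = 0
    rw [hconst, Polynomial.derivative_C]
  rw [hD0] at hD
  have hw : ∀ j, ((Polynomial.derivative' (R := R)).restrictScalars K) (w j) =
      Polynomial.C (MvPolynomial.C (v j)) := by
    intro j
    change Polynomial.derivative (w j) = _
    simp [w]
  -- At `s = 0` the identity `F' = 0` reads `∇f · v = 0`.
  have := congrArg (Polynomial.eval 0) hD
  simp only [hw, smul_eq_mul, Polynomial.eval_finsetSum, Polynomial.eval_mul, heval0,
    Polynomial.eval_C, Polynomial.eval_zero] at this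
  rw [dirDeriv, this]
  exact Finset.sum_congr rfl fun j _ => mul_comm _ _

/-- The automorphism `x ↦ x + b` of the polynomial ring. -/
noncomputable def shiftEquiv (b : Fin 3 → K) :
    MvPolynomial (Fin 3) K ≃ₐ[K] MvPolynomial (Fin 3) K :=
  AlgEquiv.ofAlgHom
    (MvPolynomial.aeval fun j => MvPolynomial.X j + MvPolynomial.C (b j))
    (MvPolynomial.aeval fun j => MvPolynomial.X j + MvPolynomial.C (-b j))
    (by ext j; simp [MvPolynomial.algebraMap_eq]) (by ext j; simp [MvPolynomial.algebraMap_eq])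

theorem shiftEquiv_apply (b : Fin 3 → K) (q : MvPolynomial (Fin 3) K) :
    shiftEquiv b q =
      MvPolynomial.aeval (fun j => MvPolynomial.X j + MvPolynomial.C (b j)) q := rfl

theorem eval_shiftEquiv (b x : Fin 3 → K) (q : MvPolynomial (Fin 3) K) :
    MvPolynomial.eval x (shiftEquiv b q) = MvPolynomial.eval (x + b) q := by
  rw [shiftEquiv_apply, MvPolynomial.aeval_def, MvPolynomial.eval_eval₂]
  simp only [map_add, MvPolynomial.eval_X, MvPolynomial.eval_C]
  rw [MvPolynomial.algebraMap_eq]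
  have : (MvPolynomial.eval x).comp MvPolynomial.C = RingHom.id K := by ext a; simp
  rw [this]
  rfl

/-! ### The factorization of the shifted equation -/

theorem eval_shifted (f : MvPolynomial (Fin 3) K) (P : Fin 3 → RatFunc K) (x : Fin 3 → K) :
    MvPolynomial.eval (fun j => RatFunc.C (x j)) (shifted f P) =
      MvPolynomial.aeval (translate P x) f := by
  rw [shifted]
  induction f using MvPolynomial.induction_on with
  | C a =>
    rw [MvPolynomial.aeval_C, MvPolynomial.aeval_C, MvPolynomial.algebraMap_apply,
      MvPolynomial.eval_C]
  | add p q hp hq => rw [map_add, map_add, map_add, hp, hq]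
  | mul_X p i hp => rw [map_mul, map_mul, map_mul, hp]; simp [translate]

theorem eval_liftPoly (q : MvPolynomial (Fin 3) K) (x : Fin 3 → K) :
    MvPolynomial.eval (fun j => RatFunc.C (x j)) (liftPoly q) =
      RatFunc.C (MvPolynomial.eval x q) := by
  rw [liftPoly, MvPolynomial.eval_map, RatFunc.algebraMap_eq_C]
  exact (MvPolynomial.eval₂_comp RatFunc.C x q).symm

/-- `Ψ(x, t₁)` at a point `x`, as a polynomial in `t₁`. -/
noncomputable def psiAt {n : ℕ} (h : Fin (n + 1) → MvPolynomial (Fin 3) K) (x : Fin 3 → K) :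
    Polynomial K :=
  ∑ i : Fin (n + 1), Polynomial.C (MvPolynomial.eval x (h i)) * Polynomial.X ^ (i : ℕ)

theorem eval_psi {n : ℕ} (h : Fin (n + 1) → MvPolynomial (Fin 3) K) (x : Fin 3 → K) :
    MvPolynomial.eval (fun j => RatFunc.C (x j)) (psi h) =
      algebraMap (Polynomial K) (RatFunc K) (psiAt h x) := by
  simp [psi, psiAt, eval_liftPoly, map_sum, RatFunc.algebraMap_C]

theorem psiAt_eq_zero_iff {n : ℕ} {h : Fin (n + 1) → MvPolynomial (Fin 3) K} {x : Fin 3 → K} :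
    psiAt h x = 0 ↔ ∀ i, MvPolynomial.eval x (h i) = 0 := by
  constructor
  · intro h0 i
    have := congrArg (fun q => Polynomial.coeff q (i : ℕ)) h0
    simp only [psiAt, Polynomial.finsetSum_coeff, Polynomial.coeff_C_mul_X_pow,
      Polynomial.coeff_zero] at this
    rw [Finset.sum_eq_single i] at this
    · simpa using this
    · intro j _ hj
      rw [if_neg]
      exact fun hij => hj (Fin.ext hij.symm)
    · simp
  · intro h0
    simp [psiAt, h0]

variable {f : MvPolynomial (Fin 3) K} {P₁ : Fin 3 → RatFunc K} {htilde : MvPolynomial (Fin 3) K}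
  {n : ℕ} {h : Fin (n + 1) → MvPolynomial (Fin 3) K} {p : RatFunc K}

theorem IsFactorization.aeval_translate (hfac : IsFactorization f P₁ htilde h p)
    (x : Fin 3 → K) :
    MvPolynomial.aeval (translate P₁ x) f =
      RatFunc.C (MvPolynomial.eval x htilde) *
        algebraMap (Polynomial K) (RatFunc K) (psiAt h x) * p := by
  rw [← eval_shifted, hfac.eq, map_mul, map_mul, MvPolynomial.eval_C, eval_psi, eval_liftPoly]

/-- Specialize `t₁ = u` away from the poles of `P₁` and `p`; the cofactor is `Ψ(x, u) p(u)`. -/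
theorem IsFactorization.shiftEquiv_eq [Infinite K] (hfac : IsFactorization f P₁ htilde h p)
    {u : K} (hu : DefinedAt P₁ u) (hp : p.denom.eval u ≠ 0) :
    ∃ g, shiftEquiv (valueAt P₁ u) f = htilde * g := by
  refine ⟨(∑ i, h i * MvPolynomial.C (u ^ (i : ℕ))) * MvPolynomial.C (p.eval (RingHom.id K) u),
    MvPolynomial.funext fun x => ?_⟩
  have h1 := congrArg (RatFunc.eval (RingHom.id K) u) (hfac.aeval_translate x)
  have h2 : (algebraMap (Polynomial K) (RatFunc K) (psiAt h x)).denom.eval u ≠ 0 := by simp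
  rw [(eval_aeval (hu.translate x) f).2, valueAt_translate hu,
    eval_mul_of_denom (denom_eval_mul (denom_eval_C _ _) h2) hp,
    eval_mul_of_denom (denom_eval_C _ _) h2, RatFunc.eval_C, RatFunc.eval_algebraMap] at h1
  rw [eval_shiftEquiv, add_comm x, h1]
  simp [psiAt, Polynomial.eval_finsetSum, map_sum, mul_assoc]

theorem Nonconstant.eventually_valueAt_ne {P : Fin 3 → RatFunc K} (hP : Nonconstant P)
    (c : Fin 3 → K) : ∀ᶠ t in cofinite, valueAt P t ≠ c := by
  obtain ⟨j, hj⟩ : ∃ j, P j - RatFunc.C (c j) ≠ 0 := by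
    by_contra! h0
    exact hP ⟨c, fun j => sub_eq_zero.1 (h0 j)⟩
  filter_upwards [eventually_eval_ne_zero hj, eventually_definedAt P] with t h1 h2 h3
  apply h1
  rw [sub_eq_add_neg, ← map_neg, eval_add_of_denom (h2 j) (denom_eval_C _ _), RatFunc.eval_C,
    ← congrFun h3 j]
  simp [valueAt]

/-- On a surface that is not cylindrical, the factor `h̃` is constant. -/
theorem IsFactorization.isUnit_htilde [CharZero K] (hf : Irreducible f)
    (hcyl : ¬ IsCylindrical f) (hP₁ : Nonconstant P₁)
    (hfac : IsFactorization f P₁ htilde h p) : IsUnit htilde := by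
  by_contra hunit
  have key : ∀ u, DefinedAt P₁ u → p.denom.eval u ≠ 0 →
      Associated htilde (shiftEquiv (valueAt P₁ u) f) := by
    intro u hu hpu
    obtain ⟨g, hg⟩ := hfac.shiftEquiv_eq hu hpu
    have hirr : Irreducible (shiftEquiv (valueAt P₁ u) f) :=
      (MulEquiv.irreducible_iff (shiftEquiv (valueAt P₁ u))).2 hf
    have hgu : IsUnit g := (hirr.isUnit_or_isUnit hg).resolve_left hunit
    rw [hg]
    exact associated_mul_unit_right _ _ hgu
  obtain ⟨u, hu, hpu⟩ := ((eventually_definedAt P₁).and (eventually_denom p)).exists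
  -- Two parameters with distinct points `P₁(u) ≠ P₁(w)`: their difference is the direction in which
  -- `f` would be cylindrical.
  obtain ⟨w, ⟨hw, hpw⟩, hne⟩ := (((eventually_definedAt P₁).and (eventually_denom p)).and
    (hP₁.eventually_valueAt_ne (valueAt P₁ u))).exists
  obtain ⟨c, hc⟩ := (key u hu hpu).symm.trans (key w hw hpw)
  obtain ⟨d, -, hd⟩ := MvPolynomial.isUnit_iff_eq_C_of_isReduced.1 c.isUnit
  refine hcyl ⟨valueAt P₁ w - valueAt P₁ u, sub_ne_zero.2 hne,
    dirDeriv_eq_zero_of_shift (c := d) hf.ne_zero ?_⟩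
  rw [← shiftEquiv_apply]
  have := congrArg (shiftEquiv (-valueAt P₁ u)) hc
  refine MvPolynomial.funext fun x => ?_
  have h2 := congrArg (MvPolynomial.eval x) this
  rw [eval_shiftEquiv, eval_shiftEquiv, map_mul, eval_shiftEquiv, hd, neg_add_cancel_right,
    MvPolynomial.eval_C] at h2
  rw [eval_shiftEquiv, map_mul, MvPolynomial.eval_C, mul_comm, h2]
  rw [eval_shiftEquiv]
  congr 2
  abel

theorem IsFactorization.aeval_translate_eq_zero_iff [CharZero K] (hf : Irreducible f)
    (hcyl : ¬ IsCylindrical f) (hP₁ : Nonconstant P₁)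
    (hfac : IsFactorization f P₁ htilde h p) {x : Fin 3 → K} :
    MvPolynomial.aeval (translate P₁ x) f = 0 ↔ ∀ i, MvPolynomial.eval x (h i) = 0 := by
  -- If `p = 0`, then `f` vanishes at every `y = P₁(u) + (y - P₁(u))`.
  have hp : p ≠ 0 := by
    rintro rfl
    obtain ⟨u, hu⟩ := (eventually_definedAt P₁).exists
    refine hf.ne_zero (MvPolynomial.funext fun y => ?_)
    have := aeval_translate_eq_zero_iff.1
      ((hfac.aeval_translate (y - valueAt P₁ u)).trans (mul_zero _)) u hu
    rwa [add_sub_cancel] at this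
  have hunit := (hfac.isUnit_htilde hf hcyl hP₁).map (MvPolynomial.eval x)
  have hC : RatFunc.C (MvPolynomial.eval x htilde) ≠ 0 :=
    (map_ne_zero _).2 hunit.ne_zero
  rw [hfac.aeval_translate, ← psiAt_eq_zero_iff]
  simp [hp, hC]

end TransSurf

/-! ### Elimination of a variable -/

/-- By Gauss's lemma `F` stays irreducible over the fraction field and still does not divide `G`, so
a Bézout identity exists there; clearing its denominators gives the constant. -/
theorem Polynomial.exists_C_eq_of_not_dvd {A : Type*} [CommRing A] [IsDomain A]
    [UniqueFactorizationMonoid A] {F G : Polynomial A} (hF : Irreducible F) (hFG : ¬ F ∣ G) :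
    ∃ a : A, a ≠ 0 ∧ ∃ U V : Polynomial A, U * F + V * G = Polynomial.C a := by
  rcases eq_or_ne F.natDegree 0 with hdeg | hdeg
  · refine ⟨F.coeff 0, ?_, 1, 0, ?_⟩
    · intro h0
      rw [Polynomial.eq_C_of_natDegree_eq_zero hdeg, h0, Polynomial.C_0] at hF
      exact not_irreducible_zero hF
    · rw [one_mul, zero_mul, add_zero]
      exact Polynomial.eq_C_of_natDegree_eq_zero hdeg
  let L := FractionRing A
  have hprim := hF.isPrimitive hdeg
  have hirr : Irreducible (F.map (algebraMap A L)) :=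
    (hprim.irreducible_iff_irreducible_map_fraction_map).1 hF
  have hnd : ¬ F.map (algebraMap A L) ∣ G.map (algebraMap A L) := fun hd =>
    hFG (hprim.dvd_of_fraction_map_dvd_fraction_map (K := L) hd)
  obtain ⟨u, v, huv⟩ := (hirr.coprime_iff_not_dvd).2 hnd
  obtain ⟨b, hb0, hb⟩ := IsLocalization.integerNormalization_spec (nonZeroDivisors A) u
  obtain ⟨c, hc0, hc⟩ := IsLocalization.integerNormalization_spec (nonZeroDivisors A) v
  rw [Algebra.smul_def, IsScalarTower.algebraMap_apply A L, ← Polynomial.C_eq_algebraMap] at hb hc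
  refine ⟨b * c, mul_ne_zero (nonZeroDivisors.ne_zero hb0) (nonZeroDivisors.ne_zero hc0),
    Polynomial.C c * IsLocalization.integerNormalization (nonZeroDivisors A) u,
    Polynomial.C b * IsLocalization.integerNormalization (nonZeroDivisors A) v, ?_⟩
  apply Polynomial.map_injective _ (IsFractionRing.injective A L)
  simp only [Polynomial.map_add, Polynomial.map_mul, Polynomial.map_C, hb, hc, map_mul]
  linear_combination (Polynomial.C (algebraMap A L b) * Polynomial.C (algebraMap A L c)) * huv

namespace TransSurf

variable {K : Type*} [Field K]

/-- Regard both polynomials as polynomials in `xₖ` over the ring in the other two variables; the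
Bézout constant lies in that ring. -/
theorem exists_elimination (k : Fin 3) {f g : MvPolynomial (Fin 3) K} (hf : Irreducible f)
    (hfg : ¬ f ∣ g) : ∃ r : MvPolynomial (Fin 3) K, r ≠ 0 ∧ MvPolynomial.pderiv k r = 0 ∧
      ∃ u v, u * f + v * g = r := by
  let e : MvPolynomial (Fin 3) K ≃ₐ[K] Polynomial (MvPolynomial (Fin 2) K) :=
    (MvPolynomial.renameEquiv K (finSuccEquiv' k)).trans (MvPolynomial.optionEquivLeft K (Fin 2))
  obtain ⟨a, ha, U, V, hUV⟩ := Polynomial.exists_C_eq_of_not_dvd (F := e f) (G := e g)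
    ((MulEquiv.irreducible_iff e).2 hf) (fun h => hfg ((map_dvd_iff e).1 h))
  have hinj : Function.Injective (k.succAbove) := Fin.succAbove_right_injective
  refine ⟨MvPolynomial.rename k.succAbove a, ?_, ?_, e.symm U, e.symm V, ?_⟩
  · exact fun h0 => ha ((MvPolynomial.rename_injective _ hinj) (h0.trans (map_zero _).symm))
  · classical
    apply MvPolynomial.pderiv_eq_zero_of_notMem_vars
    intro hk
    obtain ⟨i, -, hi⟩ := Finset.mem_image.1 (MvPolynomial.vars_rename _ _ hk)
    exact Fin.succAbove_ne k i hi
  · apply e.injective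
    rw [map_add, map_mul, map_mul, AlgEquiv.apply_symm_apply, AlgEquiv.apply_symm_apply, hUV]
    have : (e.toAlgHom.comp (MvPolynomial.rename k.succAbove)) =
        ((Polynomial.CAlgHom (R := K) (A := MvPolynomial (Fin 2) K))) := by
      apply MvPolynomial.algHom_ext
      intro i
      simp [e]
    exact (congrArg (fun φ => φ a) this).symm

/-! ### Lowering the degree by partial derivatives -/

theorem totalDegree_pderiv_lt {i : Fin 3} {r : MvPolynomial (Fin 3) K}
    (h : MvPolynomial.pderiv i r ≠ 0) :
    (MvPolynomial.pderiv i r).totalDegree < r.totalDegree := by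
  have key : ∀ m ∈ (MvPolynomial.pderiv i r).support, (m.sum fun _ e => e) < r.totalDegree := by
    intro m hm
    rw [MvPolynomial.mem_support_iff, MvPolynomial.coeff_pderiv] at hm
    have hm' : m + Finsupp.single i 1 ∈ r.support :=
      MvPolynomial.mem_support_iff.2 fun h0 => hm (by simp [h0])
    have := MvPolynomial.le_totalDegree hm'
    rw [Finsupp.sum_add_index' (by simp) (by simp), Finsupp.sum_single_index rfl] at this
    omega
  have hne : (MvPolynomial.pderiv i r).support.Nonempty := MvPolynomial.support_nonempty.2 h
  obtain ⟨m, hm⟩ := hne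
  rw [MvPolynomial.totalDegree, Finset.sup_lt_iff (lt_of_le_of_lt (Nat.zero_le _) (key m hm))]
  exact key

theorem eq_C_of_pderiv_eq_zero [CharZero K] {r : MvPolynomial (Fin 3) K}
    (h : ∀ i, MvPolynomial.pderiv i r = 0) : r = MvPolynomial.C (MvPolynomial.coeff 0 r) := by
  ext m
  rw [MvPolynomial.coeff_C]
  split_ifs with hm
  · rw [hm]
  · obtain ⟨i, hi⟩ : ∃ i, m i ≠ 0 := by
      by_contra! h0
      exact hm (Finsupp.ext fun i => (h0 i).symm)
    have h1 : Finsupp.single i 1 ≤ m := by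
      rw [Finsupp.single_le_iff]; omega
    have h2 := MvPolynomial.coeff_pderiv (i := i) r (m - Finsupp.single i 1)
    rw [h i, MvPolynomial.coeff_zero, tsub_add_cancel_of_le h1] at h2
    rcases mul_eq_zero.1 h2.symm with h3 | h3
    · exact h3
    · exact absurd h3 (Nat.cast_add_one_ne_zero _)

theorem pderiv_comm (i j : Fin 3) (r : MvPolynomial (Fin 3) K) :
    MvPolynomial.pderiv i (MvPolynomial.pderiv j r) =
      MvPolynomial.pderiv j (MvPolynomial.pderiv i r) := by
  have : ⁅MvPolynomial.pderiv (R := K) i, MvPolynomial.pderiv (R := K) j⁆ = 0 := by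
    apply MvPolynomial.derivation_ext
    intro l
    classical
    simp [Derivation.commutator_apply, MvPolynomial.pderiv_X, Pi.single_apply, apply_ite]
  have h2 := congrArg (fun D => D r) this
  simpa [Derivation.commutator_apply, sub_eq_zero] using h2

/-- A nonzero polynomial free of `xₖ` in a proper ideal has an iterated derivative in the ideal
some partial derivative of which is outside of the ideal. -/
theorem exists_pderiv_notMem [CharZero K] {I : Ideal (MvPolynomial (Fin 3) K)} (hI : I ≠ ⊤)
    {k : Fin 3} {r : MvPolynomial (Fin 3) K} (hr0 : r ≠ 0) (hrI : r ∈ I)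
    (hrk : MvPolynomial.pderiv k r = 0) :
    ∃ q ∈ I, MvPolynomial.pderiv k q = 0 ∧ ∃ i, MvPolynomial.pderiv i q ∉ I := by
  induction hd : r.totalDegree using Nat.strong_induction_on generalizing r with
  | _ d ih =>
    by_cases hall : ∀ i, MvPolynomial.pderiv i r ∈ I
    · by_cases hz : ∀ i, MvPolynomial.pderiv i r = 0
      -- A nonzero constant in the ideal would be a unit.
      · exfalso
        have hC := eq_C_of_pderiv_eq_zero hz
        have hc : MvPolynomial.coeff 0 r ≠ 0 := fun h0 => hr0 (by rw [hC, h0, map_zero])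
        refine hI (Ideal.eq_top_of_isUnit_mem I hrI ?_)
        rw [hC]
        exact (IsUnit.mk0 _ hc).map MvPolynomial.C
      · push Not at hz
        obtain ⟨i, hi⟩ := hz
        -- A nonzero partial derivative has smaller degree, and is still free of `xₖ` because
        -- partial derivatives commute.
        exact ih _ (hd ▸ totalDegree_pderiv_lt hi) hi (hall i)
          (by rw [pderiv_comm, hrk, map_zero]) rfl
    · push Not at hall
      exact ⟨r, hrI, hrk, hall⟩

/-! ### The derivation of the field of rational functions -/

/-- The first-order Taylor expansion `x(t) ↦ x(t) + x'(t) ε`. -/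
noncomputable def taylorHom (K : Type*) [Field K] :
    RatFunc K →ₐ[K] TrivSqZeroExt (RatFunc K) (RatFunc K) :=
  IsLocalization.liftAlgHom (M := nonZeroDivisors (Polynomial K))
    (f := Polynomial.aeval (TrivSqZeroExt.inl RatFunc.X + TrivSqZeroExt.inr 1)) (by
      rintro ⟨q, hq⟩
      -- A dual number is a unit as soon as its constant part is; here that part is `q` itself.
      rw [TrivSqZeroExt.isUnit_iff_isUnit_fst]
      have : (TrivSqZeroExt.fstHom K (RatFunc K) (RatFunc K)).comp (Polynomial.aeval
          (TrivSqZeroExt.inl RatFunc.X + TrivSqZeroExt.inr 1)) =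
          Polynomial.aeval (RatFunc.X : RatFunc K) := by
        apply Polynomial.algHom_ext
        simp
      have h2 := congrArg (fun φ => φ q) this
      have h3 : TrivSqZeroExt.fst (Polynomial.aeval (TrivSqZeroExt.inl RatFunc.X +
          TrivSqZeroExt.inr 1 : TrivSqZeroExt (RatFunc K) (RatFunc K)) q) =
          algebraMap (Polynomial K) (RatFunc K) q :=
        h2.trans (RatFunc.aeval_X_left_eq_algebraMap q)
      change IsUnit (TrivSqZeroExt.fst (Polynomial.aeval _ q))
      rw [h3]
      exact IsUnit.mk0 _ (by simpa using nonZeroDivisors.ne_zero hq))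

theorem taylorHom_X : taylorHom K RatFunc.X = TrivSqZeroExt.inl RatFunc.X + TrivSqZeroExt.inr 1 := by
  rw [← RatFunc.algebraMap_X, taylorHom, IsLocalization.liftAlgHom_apply, IsLocalization.lift_eq]
  simp

theorem fst_taylorHom (x : RatFunc K) : (taylorHom K x).fst = x := by
  have : (TrivSqZeroExt.fstHom K (RatFunc K) (RatFunc K)).comp (taylorHom K) =
      AlgHom.id K (RatFunc K) := by
    apply IsLocalization.algHom_ext (nonZeroDivisors (Polynomial K))
    apply Polynomial.algHom_ext
    change (taylorHom K (algebraMap (Polynomial K) (RatFunc K) Polynomial.X)).fst =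
      algebraMap (Polynomial K) (RatFunc K) Polynomial.X
    rw [RatFunc.algebraMap_X, taylorHom_X]
    simp
  exact congrArg (fun φ => φ x) this

/-- The derivation `d/dt` of `K(t)`. -/
noncomputable def ratDeriv (K : Type*) [Field K] : Derivation K (RatFunc K) (RatFunc K) where
  toLinearMap := (TrivSqZeroExt.sndHom (RatFunc K) (RatFunc K)).restrictScalars K ∘ₗ
    (taylorHom K).toLinearMap
  map_one_eq_zero' := by simp
  leibniz' x y := by simp [fst_taylorHom, TrivSqZeroExt.snd_mul, mul_comm]

theorem ratDeriv_algebraMap (q : Polynomial K) :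
    ratDeriv K (algebraMap (Polynomial K) (RatFunc K) q) =
      algebraMap (Polynomial K) (RatFunc K) (Polynomial.derivative q) := by
  have hX : ratDeriv K RatFunc.X = 1 := by
    change (taylorHom K RatFunc.X).snd = 1
    rw [taylorHom_X]; simp
  induction q using Polynomial.induction_on' with
  | add p q hp hq => simp only [map_add, hp, hq]
  | monomial n a =>
    rw [RatFunc.algebraMap_monomial, Derivation.leibniz, ← RatFunc.algebraMap_eq_C,
      Derivation.map_algebraMap, Derivation.leibniz_pow, hX, Polynomial.derivative_monomial,
      RatFunc.algebraMap_monomial, RatFunc.algebraMap_eq_C]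
    simp [mul_assoc]

theorem ratDeriv_C (c : K) : ratDeriv K (RatFunc.C c) = 0 := by
  rw [← RatFunc.algebraMap_eq_C, Derivation.map_algebraMap]

/-- In lowest terms `n/d`, a zero derivative means `n d' = n' d`, so `d ∣ d'`; by degree `d' = 0`,
and then `n' = 0`. -/
theorem exists_eq_C_of_ratDeriv_eq_zero [CharZero K] {x : RatFunc K} (hx : ratDeriv K x = 0) :
    ∃ c, x = RatFunc.C c := by
  have h1 : x * algebraMap (Polynomial K) (RatFunc K) x.denom =
      algebraMap (Polynomial K) (RatFunc K) x.num := by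
    exact ((div_eq_iff (RatFunc.algebraMap_ne_zero x.denom_ne_zero)).1
      (RatFunc.num_div_denom x)).symm
  have h2 := congrArg (ratDeriv K) h1
  rw [Derivation.leibniz, hx, smul_zero, add_zero, ratDeriv_algebraMap, ratDeriv_algebraMap,
    smul_eq_mul] at h2
  have h3 : x.num * Polynomial.derivative x.denom = Polynomial.derivative x.num * x.denom := by
    apply RatFunc.algebraMap_injective K
    rw [map_mul, map_mul, ← h1, ← h2]
    ring
  have hd : Polynomial.derivative x.denom = 0 := by
    by_contra h0
    have hdvd : x.denom ∣ Polynomial.derivative x.denom :=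
      (RatFunc.isCoprime_num_denom x).symm.dvd_of_dvd_mul_left (h3 ▸ dvd_mul_left _ _)
    exact Polynomial.not_dvd_of_degree_lt h0
      (Polynomial.degree_derivative_lt x.denom_ne_zero) hdvd
  have hn : Polynomial.derivative x.num = 0 := by
    rw [hd, mul_zero] at h3
    exact (mul_eq_zero.1 h3.symm).resolve_right x.denom_ne_zero
  refine (RatFunc.eq_C_iff x).2 ?_
  exact ⟨Polynomial.derivative_eq_zero.1 hn, Polynomial.derivative_eq_zero.1 hd⟩

/-! ### Parametrizations with a constant tangent direction -/

theorem isLine_curve [Infinite K] {P : Fin 3 → RatFunc K} (hP : Nonconstant P) {i₀ : Fin 3}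
    {b v : Fin 3 → K} (hv : v i₀ = 1)
    (h : ∀ i, P i = RatFunc.C (b i) + RatFunc.C (v i) * P i₀) : IsLine (curve P) := by
  refine ⟨b, v, fun h0 => by simp [h0] at hv, Set.Subset.antisymm ?_ ?_⟩
  · intro y hy
    refine ⟨y i₀, funext fun i => ?_⟩
    have := mem_curve.1 hy (MvPolynomial.X i - MvPolynomial.C (b i) -
      MvPolynomial.C (v i) * MvPolynomial.X i₀) (by
        simp only [map_sub, map_mul, MvPolynomial.aeval_X, MvPolynomial.aeval_C,
          RatFunc.algebraMap_eq_C]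
        rw [h i]; ring)
    simp only [map_sub, map_mul, MvPolynomial.eval_X, MvPolynomial.eval_C] at this
    simp only [Pi.add_apply, Pi.smul_apply, smul_eq_mul]
    linear_combination this
  · rintro _ ⟨s, rfl⟩
    refine mem_curve.2 fun q hq => ?_
    -- Restricted to the line, `q` is a polynomial in one variable that vanishes at the
    -- transcendental element `P i₀`, hence is zero.
    let w : Fin 3 → Polynomial K := fun j =>
      Polynomial.C (b j) + Polynomial.C (v j) * Polynomial.X
    have htr : Transcendental K (P i₀) := by
      apply RatFunc.transcendental_of_ne_C
      rintro ⟨c, hc⟩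
      exact hP ⟨fun i => b i + v i * c, fun i => by rw [h i, hc]; simp⟩
    have h1 : Polynomial.aeval (P i₀) (MvPolynomial.aeval w q) = 0 := by
      rw [← AlgHom.comp_apply, MvPolynomial.comp_aeval, ← hq]
      congr 2
      funext j
      rw [h j]
      simp [w, RatFunc.algebraMap_eq_C]
    have h2 : MvPolynomial.aeval w q = 0 := by
      by_contra h0
      exact htr ⟨_, h0, h1⟩
    have h3 := congrArg (Polynomial.aeval s) h2
    rw [map_zero, ← AlgHom.comp_apply, MvPolynomial.comp_aeval] at h3
    rw [← h3, ← MvPolynomial.coe_aeval_eq_eval, RingHom.coe_coe]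
    congr 2
    funext j
    simp only [w, Pi.add_apply, Pi.smul_apply, smul_eq_mul, map_add, map_mul, Polynomial.aeval_C,
      Polynomial.aeval_X, Algebra.algebraMap_self, RingHom.id_apply, mul_comm s]

/-- If `v i₀ ≠ 0`, each `P i - (v i / v i₀) P i₀` has zero derivative and is therefore constant. -/
theorem isLine_curve_of_ratDeriv [CharZero K] {P : Fin 3 → RatFunc K} (hP : Nonconstant P)
    {v : Fin 3 → K} (hv : v ≠ 0)
    (h : ∀ i j, ratDeriv K (P i) * RatFunc.C (v j) = ratDeriv K (P j) * RatFunc.C (v i)) :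
    IsLine (curve P) := by
  obtain ⟨i₀, hi₀⟩ := Function.ne_iff.1 hv
  simp only [Pi.zero_apply] at hi₀
  have key : ∀ i, ∃ c, P i - RatFunc.C (v i / v i₀) * P i₀ = RatFunc.C c := by
    intro i
    apply exists_eq_C_of_ratDeriv_eq_zero
    rw [map_sub, Derivation.leibniz, ratDeriv_C, smul_zero, add_zero, smul_eq_mul, map_div₀]
    have : RatFunc.C (v i₀) ≠ 0 := (map_ne_zero _).2 hi₀
    field_simp
    linear_combination h i i₀
  choose b hb using key
  refine isLine_curve hP (i₀ := i₀) (b := b) (v := fun i => v i / v i₀) (div_self hi₀) fun i => ?_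
  rw [← hb i]
  ring

/-! ### Density of the sums -/

/-- The set of the points `P₁(t₁) + P₂(t₂)`. -/
def sumSet (P₁ P₂ : Fin 3 → RatFunc K) : Set (Fin 3 → K) :=
  {x | ∃ t₁ t₂, DefinedAt P₁ t₁ ∧ DefinedAt P₂ t₂ ∧ x = valueAt P₁ t₁ + valueAt P₂ t₂}

theorem mem_vanishingIdeal_sumSet {P₁ P₂ : Fin 3 → RatFunc K} {q : MvPolynomial (Fin 3) K} :
    q ∈ MvPolynomial.vanishingIdeal K (sumSet P₁ P₂) ↔ ∀ t₁ t₂, DefinedAt P₁ t₁ →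
      DefinedAt P₂ t₂ → MvPolynomial.eval (valueAt P₁ t₁ + valueAt P₂ t₂) q = 0 := by
  rw [MvPolynomial.mem_vanishingIdeal_iff]
  constructor
  · intro h t₁ t₂ h₁ h₂
    exact h _ ⟨t₁, t₂, h₁, h₂, rfl⟩
  · rintro h _ ⟨t₁, t₂, h₁, h₂, rfl⟩
    exact h t₁ t₂ h₁ h₂

theorem sum_aeval_translate_mul_ratDeriv {P : Fin 3 → RatFunc K} {x : Fin 3 → K}
    {q : MvPolynomial (Fin 3) K} (h : MvPolynomial.aeval (translate P x) q = 0) :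
    ∑ l, MvPolynomial.aeval (translate P x) (MvPolynomial.pderiv l q) * ratDeriv K (P l) = 0 := by
  have := derivation_aeval (ratDeriv K) (translate P x) q
  rw [h, map_zero] at this
  rw [this]
  refine Finset.sum_congr rfl fun l _ => ?_
  rw [smul_eq_mul, translate, map_add, ratDeriv_C, add_zero]

theorem exists_third_index {i j : Fin 3} (hij : i ≠ j) :
    ∃ k, k ≠ i ∧ k ≠ j ∧ ∀ l, l = i ∨ l = j ∨ l = k := by
  revert i j; decide

/-- Proportionality of two vectors that are orthogonal to the same nonzero vector of a
coordinate plane. -/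
theorem mul_eq_mul_of_orthogonal {L : Type*} [Field L] {i j k : Fin 3} (hij : i ≠ j)
    (hki : k ≠ i) (hkj : k ≠ j) (hl : ∀ l, l = i ∨ l = j ∨ l = k) {w a v : Fin 3 → L}
    (hwk : w k = 0) (hw : ∃ l, w l ≠ 0) (ha : ∑ l, w l * a l = 0) (hv : ∑ l, w l * v l = 0) :
    a i * v j = a j * v i := by
  have huniv : (Finset.univ : Finset (Fin 3)) = {i, j, k} := by
    ext l; simpa using hl l
  rw [huniv, Finset.sum_insert (by simp [hij, hki.symm]), Finset.sum_insert (by simp [hkj.symm]),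
    Finset.sum_singleton, hwk] at ha hv
  obtain ⟨l, hwl⟩ := hw
  apply mul_left_cancel₀ hwl
  rcases hl l with rfl | rfl | rfl
  · linear_combination v j * ha - a j * hv
  · linear_combination a i * hv - v i * ha
  · exact absurd hwk hwl

/-- If the curve of `P₁` is not a line, an irreducible polynomial that vanishes at all
`P₁(t₁) + P₂(t₂)` divides every other such polynomial. -/
theorem dvd_of_mem_vanishingIdeal_sumSet [CharZero K] {f g : MvPolynomial (Fin 3) K}
    (hf : Irreducible f) {P₁ P₂ : Fin 3 → RatFunc K} (hP₁ : Nonconstant P₁)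
    (hP₂ : Nonconstant P₂) (hline : ¬ IsLine (curve P₁))
    (hfI : f ∈ MvPolynomial.vanishingIdeal K (sumSet P₁ P₂))
    (hgI : g ∈ MvPolynomial.vanishingIdeal K (sumSet P₁ P₂)) : f ∣ g := by
  by_contra hfg
  set I := MvPolynomial.vanishingIdeal K (sumSet P₁ P₂) with hI
  have hItop : I ≠ ⊤ := by
    intro h
    obtain ⟨t₁, ht₁⟩ := (eventually_definedAt P₁).exists
    obtain ⟨t₂, ht₂⟩ := (eventually_definedAt P₂).exists
    have h1 : (1 : MvPolynomial (Fin 3) K) ∈ I := by rw [h]; trivial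
    simpa using mem_vanishingIdeal_sumSet.1 h1 t₁ t₂ ht₁ ht₂
  have hq : ∀ k, ∃ q ∈ I, MvPolynomial.pderiv k q = 0 ∧ ∃ i, MvPolynomial.pderiv i q ∉ I := by
    intro k
    obtain ⟨r, hr0, hrk, u, v, rfl⟩ := exists_elimination k hf hfg
    exact exists_pderiv_notMem hItop hr0
      (I.add_mem (I.mul_mem_left _ hfI) (I.mul_mem_left _ hgI)) hrk
  choose q hqI hqk i hi using hq
  -- For all but finitely many `τ`, the gradient of `q k` is not identically zero along the
  -- translated curve `P₁ + P₂(τ)`.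
  have hgen : ∀ k, ∀ᶠ τ in cofinite, MvPolynomial.aeval (translate P₁ (valueAt P₂ τ))
      (MvPolynomial.pderiv (i k) (q k)) ≠ 0 := by
    intro k
    have hik := hi k
    rw [mem_vanishingIdeal_sumSet] at hik
    push Not at hik
    obtain ⟨u₁, u₂, hu₁, hu₂, hne⟩ := hik
    rw [add_comm, ← valueAt_translate hu₂] at hne
    filter_upwards [eventually_eval_valueAt_ne_zero (hu₂.translate _) hne,
      eventually_definedAt P₂] with τ h1 h2 h3
    rw [valueAt_translate h2, add_comm] at h1
    exact h1 (aeval_translate_eq_zero_iff.1 h3 u₁ hu₁)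
  obtain ⟨j₀, hj₀⟩ : ∃ j, ratDeriv K (P₂ j) ≠ 0 := by
    by_contra! h0
    choose c hc using fun j => exists_eq_C_of_ratDeriv_eq_zero (h0 j)
    exact hP₂ ⟨c, hc⟩
  obtain ⟨τ, ⟨⟨hτgen, hτ⟩, hτd⟩, hτ0⟩ := ((((eventually_all.2 hgen).and
    (eventually_definedAt P₂)).and
    (eventually_definedAt fun j => ratDeriv K (P₂ j))).and (eventually_eval_ne_zero hj₀)).exists
  -- The tangent vector `P₂'(τ)`, nonzero by the choice of `τ`, will be the direction of the line.
  let v : Fin 3 → K := fun j => (ratDeriv K (P₂ j)).eval (RingHom.id K) τ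
  refine hline (isLine_curve_of_ratDeriv hP₁ (v := v) (fun h0 => hτ0 (congrFun h0 j₀)) ?_)
  intro a b
  rcases eq_or_ne a b with rfl | hab
  · rfl
  -- To compare components `a` and `b`, use the polynomial free of the third coordinate `k`: its
  -- gradient lies in the `(a, b)`-plane.
  obtain ⟨k, hka, hkb, hl⟩ := exists_third_index hab
  have hqk0 := mem_vanishingIdeal_sumSet.1 (hqI k)
  refine mul_eq_mul_of_orthogonal (a := fun l => ratDeriv K (P₁ l))
    (v := fun l => RatFunc.C (v l)) (w := fun l => MvPolynomial.aeval
      (translate P₁ (valueAt P₂ τ)) (MvPolynomial.pderiv l (q k)))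
    hab hka hkb hl (by rw [hqk, map_zero]) ⟨i k, hτgen k⟩ ?_ ?_
  · exact sum_aeval_translate_mul_ratDeriv
      (aeval_translate_eq_zero_iff.2 fun t ht => hqk0 t τ ht hτ)
  -- For each fixed `t₁`, differentiate `q k (P₁(t₁) + P₂(t₂)) = 0` in `t₂` and set `t₂ = τ`; the
  -- result for all `t₁` is an identity in `K(t₁)`.
  · have h1 : MvPolynomial.aeval (translate P₁ (valueAt P₂ τ))
        (∑ l, MvPolynomial.pderiv l (q k) * MvPolynomial.C (v l)) = 0 := by
      refine aeval_translate_eq_zero_iff.2 fun t ht => ?_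
      have h2 := sum_aeval_translate_mul_ratDeriv (aeval_translate_eq_zero_iff (P := P₂)
        (x := valueAt P₁ t) (q := q k) |>.2 fun s hs => by rw [add_comm]; exact hqk0 t s ht hs)
      have h3 := congrArg (RatFunc.eval (RingHom.id K) τ) h2
      have hτt := hτ.translate (valueAt P₁ t)
      rw [RatFunc.eval_zero, (denom_eval_finsetSum _ fun l =>
        denom_eval_mul (eval_aeval hτt _).1 (hτd l)).2] at h3
      rw [map_sum, ← h3]
      refine Finset.sum_congr rfl fun l _ => ?_
      rw [eval_mul_of_denom (eval_aeval hτt _).1 (hτd l), (eval_aeval hτt _).2,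
        valueAt_translate hτ, map_mul, MvPolynomial.eval_C, add_comm]
    rw [map_sum] at h1
    simpa [MvPolynomial.aeval_C, RatFunc.algebraMap_eq_C] using h1

theorem sumParametrizes_of_forall_eval [CharZero K] {f : MvPolynomial (Fin 3) K}
    (hf : Irreducible f) {P₁ P₂ : Fin 3 → RatFunc K} (hP₁ : Nonconstant P₁)
    (hP₂ : Nonconstant P₂) (hline : ¬ IsLine (curve P₁))
    (h : ∀ t₁ t₂, DefinedAt P₁ t₁ → DefinedAt P₂ t₂ →
      MvPolynomial.eval (valueAt P₁ t₁ + valueAt P₂ t₂) f = 0) : SumParametrizes f P₁ P₂ := by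
  have hfI := mem_vanishingIdeal_sumSet.2 h
  refine Set.Subset.antisymm ?_ ?_
  · rintro y hy q rfl
    refine mem_zariskiClosure.1 hy q ?_
    rintro _ ⟨t₁, t₂, h₁, h₂, rfl⟩
    exact h t₁ t₂ h₁ h₂
  · intro y hy
    refine mem_zariskiClosure.2 fun g hg => ?_
    have hgI : g ∈ MvPolynomial.vanishingIdeal K (sumSet P₁ P₂) :=
      mem_vanishingIdeal_sumSet.2 fun t₁ t₂ h₁ h₂ => hg _ ⟨t₁, t₂, h₁, h₂, rfl⟩
    obtain ⟨c, rfl⟩ := dvd_of_mem_vanishingIdeal_sumSet hf hP₁ hP₂ hline hfI hgI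
    rw [map_mul, hy f rfl, zero_mul]

theorem SumParametrizes.eval_eq_zero {f : MvPolynomial (Fin 3) K} {P₁ P₂ : Fin 3 → RatFunc K}
    (h : SumParametrizes f P₁ P₂) {t₁ t₂ : K} (h₁ : DefinedAt P₁ t₁) (h₂ : DefinedAt P₂ t₂) :
    MvPolynomial.eval (valueAt P₁ t₁ + valueAt P₂ t₂) f = 0 := by
  have h0 : valueAt P₁ t₁ + valueAt P₂ t₂ ∈ zeroSet {f} := by
    rw [← h]
    exact subset_zariskiClosure _ ⟨t₁, t₂, h₁, h₂, rfl⟩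
  exact h0 f rfl

/-! ### Proper reparametrization -/

/-- By Lüroth's theorem, every rational curve has a proper parametrization. -/
theorem exists_isProper_curve_eq [Infinite K] {P : Fin 3 → RatFunc K} (hP : Nonconstant P) :
    ∃ R : Fin 3 → RatFunc K, IsProper R ∧ curve R = curve P := by
  let E := IntermediateField.adjoin K (Set.range P)
  have hPE : ∀ j, P j ∈ E := fun j => IntermediateField.subset_adjoin K _ ⟨j, rfl⟩
  have hE : E ≠ ⊥ := by
    intro h0
    refine hP ?_
    have : ∀ j, ∃ c, algebraMap K (RatFunc K) c = P j := fun j =>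
      IntermediateField.mem_bot.1 (h0 ▸ hPE j)
    choose c hc using this
    exact ⟨c, fun j => by rw [← hc j, RatFunc.algebraMap_eq_C]⟩
  -- Lüroth: the field `E = K(P)` is itself a rational function field `K(s)`; `R` is `P` written in
  -- terms of `s`.
  let e := RatFunc.Luroth.algEquiv hE
  let φ : RatFunc K →ₐ[K] RatFunc K := E.val.comp e.toAlgHom
  have hφ : Function.Injective φ := φ.toRingHom.injective
  let R : Fin 3 → RatFunc K := fun j => e.symm ⟨P j, hPE j⟩
  have hR : ∀ j, φ (R j) = P j := by
    intro j
    change ((e (e.symm ⟨P j, hPE j⟩) : E) : RatFunc K) = P j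
    rw [AlgEquiv.apply_symm_apply]
  refine ⟨R, ?_, ?_⟩
  · have hmap : (IntermediateField.adjoin K (Set.range R)).map φ = E := by
      rw [IntermediateField.adjoin_map, ← Set.range_comp]
      congr 2
      funext j
      exact hR j
    refine eq_top_iff.2 fun y _ => ?_
    have hy : φ y ∈ (IntermediateField.adjoin K (Set.range R)).map φ := by
      rw [hmap]
      exact (e y).2
    obtain ⟨z, hz, hzy⟩ := hy
    rwa [← hφ hzy]
  · have hker : ∀ q : MvPolynomial (Fin 3) K,
        MvPolynomial.aeval R q = 0 ↔ MvPolynomial.aeval P q = 0 := by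
      intro q
      rw [← map_eq_zero_iff φ hφ, ← AlgHom.comp_apply, MvPolynomial.comp_aeval]
      simp only [hR]
    ext y
    simp only [mem_curve, hker]

/-! ### The main theorem -/

theorem sumParametrizes_iff_curve_subset [CharZero K] {f : MvPolynomial (Fin 3) K}
    (hf : Irreducible f) (hcyl : ¬ IsCylindrical f) {P₁ P₂ : Fin 3 → RatFunc K}
    (hP₁ : Nonconstant P₁) (hline : ¬ IsLine (curve P₁)) {htilde : MvPolynomial (Fin 3) K} {n : ℕ}
    {h : Fin (n + 1) → MvPolynomial (Fin 3) K} {p : RatFunc K}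
    (hfac : IsFactorization f P₁ htilde h p) (hP₂ : Nonconstant P₂) :
    SumParametrizes f P₁ P₂ ↔ curve P₂ ⊆ zeroSet (Set.range h) := by
  have key : ∀ x : Fin 3 → K, (∀ t, DefinedAt P₁ t →
      MvPolynomial.eval (valueAt P₁ t + x) f = 0) ↔ ∀ i, MvPolynomial.eval x (h i) = 0 :=
    fun x => aeval_translate_eq_zero_iff.symm.trans
      (hfac.aeval_translate_eq_zero_iff hf hcyl hP₁)
  constructor
  · intro hs
    rw [curve_subset_zeroSet_iff]
    rintro _ ⟨i, rfl⟩
    rw [← forall_eval_valueAt_eq_zero_iff]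
    intro t₂ h₂
    exact (key _).1 (fun t₁ h₁ => hs.eval_eq_zero h₁ h₂) i
  · intro hsub
    refine sumParametrizes_of_forall_eval hf hP₁ hP₂ hline fun t₁ t₂ h₁ h₂ => ?_
    exact (key _).2 (fun i => hsub (valueAt_mem_curve h₂) (h i) ⟨i, rfl⟩) t₁ h₁

theorem exists_curve_subset_of_isTranslational [CharZero K] {f : MvPolynomial (Fin 3) K}
    (hf : Irreducible f) (hcyl : ¬ IsCylindrical f) {a : Fin 3 → K} {P₁ : Fin 3 → RatFunc K}
    (hP₁ : IsFirstCurveParam f a P₁) {htilde : MvPolynomial (Fin 3) K} {n : ℕ}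
    {h : Fin (n + 1) → MvPolynomial (Fin 3) K} {p : RatFunc K}
    (hfac : IsFactorization f P₁ htilde h p) (htr : IsTranslational f) :
    ∃ P₂ : Fin 3 → RatFunc K, Nonconstant P₂ ∧ curve P₂ ⊆ zeroSet (Set.range h) := by
  obtain ⟨Q₁, Q₂, -, hQ₂, hs, t₀, ht₀, -, hcurve⟩ := hP₁.of_translational htr
  refine ⟨translate Q₂ (-valueAt Q₂ t₀), hQ₂.translate _, ?_⟩
  refine (sumParametrizes_iff_curve_subset hf hcyl hP₁.proper.nonconstant hP₁.not_line hfac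
    (hQ₂.translate _)).1 ?_
  refine sumParametrizes_of_forall_eval hf hP₁.proper.nonconstant (hQ₂.translate _)
    hP₁.not_line fun t₁ t₂ h₁ h₂ => ?_
  rw [definedAt_translate_iff] at h₂
  have hmem : valueAt P₁ t₁ ∈ curve (translate Q₁ (valueAt Q₂ t₀)) :=
    hcurve ▸ valueAt_mem_curve h₁
  rw [valueAt_translate h₂, ← eval_shiftEquiv]
  -- `P₁` and `Q₁ + Q₂(t⁰)` share only their curve, not their parameter. With `t₂` fixed, the
  -- translate of `f` by `Q₂(t₂) - Q₂(t⁰)` vanishes at the values of `Q₁ + Q₂(t⁰)`, hence on their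
  -- closure, which contains `P₁(t₁)`.
  refine mem_curve.1 hmem _ (aeval_translate_eq_zero_iff.2 fun t ht => ?_)
  rw [eval_shiftEquiv, show valueAt Q₁ t + valueAt Q₂ t₀ + (valueAt Q₂ t₂ + -valueAt Q₂ t₀) =
    valueAt Q₁ t + valueAt Q₂ t₂ by abel]
  exact hs.eval_eq_zero ht h₂

end TransSurf

theorem theorem2 {K : Type*} [Field K] [IsAlgClosed K] [CharZero K]
    (f : MvPolynomial (Fin 3) K) (hf : Irreducible f) (hcyl : ¬ TransSurf.IsCylindrical f)
    (a : Fin 3 → K) (P₁ : Fin 3 → RatFunc K) (hP₁ : TransSurf.IsFirstCurveParam f a P₁)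
    (htilde : MvPolynomial (Fin 3) K) (n : ℕ) (h : Fin (n + 1) → MvPolynomial (Fin 3) K)
    (p : RatFunc K) (hfac : TransSurf.IsFactorization f P₁ htilde h p) :
    List.TFAE [
      TransSurf.IsTranslational f,
      ∃ P₂ : Fin 3 → RatFunc K, TransSurf.IsProper P₂ ∧ TransSurf.SumParametrizes f P₁ P₂,
      ∃ P₂ : Fin 3 → RatFunc K, TransSurf.Nonconstant P₂ ∧
        TransSurf.curve P₂ ⊆ TransSurf.zeroSet (Set.range h)] ∧
    (∀ P₂ : Fin 3 → RatFunc K, TransSurf.Nonconstant P₂ →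
      (TransSurf.SumParametrizes f P₁ P₂ ↔
        TransSurf.curve P₂ ⊆ TransSurf.zeroSet (Set.range h))) ∧
    (∀ D : Set (Fin 3 → K), TransSurf.IsRationalCurve D →
      D ⊆ TransSurf.zeroSet (Set.range h) →
      ∃ P₂ : Fin 3 → RatFunc K, TransSurf.IsProper P₂ ∧ TransSurf.curve P₂ = D ∧
        TransSurf.SumParametrizes f P₁ P₂) := by
  have hnc := hP₁.proper.nonconstant
  have hiff : ∀ P₂ : Fin 3 → RatFunc K, TransSurf.Nonconstant P₂ →
      (TransSurf.SumParametrizes f P₁ P₂ ↔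
        TransSurf.curve P₂ ⊆ TransSurf.zeroSet (Set.range h)) := fun P₂ hP₂ =>
    TransSurf.sumParametrizes_iff_curve_subset hf hcyl hnc hP₁.not_line hfac hP₂
  have hproper : ∀ D : Set (Fin 3 → K), TransSurf.IsRationalCurve D →
      D ⊆ TransSurf.zeroSet (Set.range h) →
      ∃ P₂ : Fin 3 → RatFunc K, TransSurf.IsProper P₂ ∧ TransSurf.curve P₂ = D ∧
        TransSurf.SumParametrizes f P₁ P₂ := by
    rintro _ ⟨P, hP, rfl⟩ hD
    obtain ⟨R, hR, hRP⟩ := TransSurf.exists_isProper_curve_eq hP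
    exact ⟨R, hR, hRP, (hiff R hR.nonconstant).2 (hRP ▸ hD)⟩
  refine ⟨?_, hiff, hproper⟩
  tfae_have 1 → 3 := TransSurf.exists_curve_subset_of_isTranslational hf hcyl hP₁ hfac
  tfae_have 3 → 2 := by
    rintro ⟨P₂, hP₂, hsub⟩
    obtain ⟨R, hR, -, hs⟩ := hproper _ ⟨P₂, hP₂, rfl⟩ hsub
    exact ⟨R, hR, hs⟩
  tfae_have 2 → 1 := by
    rintro ⟨P₂, hP₂, hs⟩
    exact ⟨P₁, P₂, hnc, hP₂.nonconstant, hs⟩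
  tfae_finish
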